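/- \textbf{Setting.} In \emph{online budgeted allocation} there are finitely many agents and finitely many items. Agent $i$ has a budget $B_i\ge 0$ and makes a bid $b_{ij}\ge 0$ on item $j$. Items arrive one at a time in an arbitrary order; on arrival an item is irrevocably given to an agent or left unallocated. If agent $i$ receives the set $S_i$ of items, the revenue is $\sum_i\min\bigl(B_i,\sum_{j\in S_i}b_{ij}\bigr)$; let $\mathrm{OPT}_A$ be the largest revenue of an (offline) allocation. In the \emph{single bids case} there are values $b_i>0$, known in advance like the budgets, with $b_{ij}\in\{0,b_i\}$ for all $i,j$. In \emph{online vertex-weighted bipartite matching} the vertices $u\in U$ and their weights $b_u$ are known in advance and the vertices $v\in V$ arrive one at a time; the gain of a matching is the sum of the weights of the matched vertices of $U$. \textsc{Perturbed-Greedy} picks $x_u$ ($u\in U$) independently and uniformly at random from $[0,1]$ and matches each arriving $v\in V$ to the unmatched neighbour $u$ with the highest value of $b_u\psi(x_u)$, where $\psi(x)=1-e^{-(1-x)}$ (if $v$ has an unmatched neighbour), breaking ties by a fixed vertex identifier. To a single-bids instance we associate the following matching instance. Let $n_i=\lfloor B_i/b_i\rfloor$ and $r_i=B_i-n_ib_i$.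 Agent $i$ is replaced by a set $U_i$ of $n_i$ vertices of weight $b_i$ and, if $r_i>0$, one more vertex of weight $r_i$. The set $V$ is the set of items, arriving in the same order, and $u\in U_i$ is adjacent to item $j$ if and only if $b_{ij}\ne 0$. Let $\mathrm{OPT}_M$ be the largest gain of a matching in this instance. A matching induces the allocation that gives every item matched to a vertex of $U_i$ to agent $i$. \textsc{Perturbed-Greedy} for the single bids case is the online algorithm that outputs the allocation induced by the matching of \textsc{Perturbed-Greedy} on this instance. \textbf{Corollary.} For every single-bids instance, every arrival order of the items and every choice of the identifiers: \begin{enumerate} \item $\mathrm{OPT}_M=\mathrm{OPT}_A$. \item The revenue of the allocation induced by any matching is at least the gain of the matching. In particular, for every outcome of the random choices, and hence in expectation, the revenue of \textsc{Perturbed-Greedy} is at least the gain of its matching. \item \textsc{Perturbed-Greedy} achieves a competitive ratio of $1-1/e$: its expected revenue is at least $\left(1-\frac1e\right)\mathrm{OPT}_A$. \end{enumerate} -/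

import Mathlib

/-! ### Online vertex-weighted bipartite matching -/

/-- A bipartite graph with offline side `U`, online side `V`, and a weight on each offline vertex. -/
structure WeightedBipartite (U V : Type*) where
  adj : U → V → Prop
  weight : U → ℝ

namespace WeightedBipartite

variable {U V : Type*}

/-- `M v = some u` means that `v` is matched to `u`; `M v = none` that `v` is unmatched. -/
def IsMatching (G : WeightedBipartite U V) (M : V → Option U) : Prop :=
  (∀ v u, M v = some u → G.adj u v) ∧
    ∀ v w u, M v = some u → M w = some u → v = w

open Classical in
/-- The sum of the weights of the matched vertices of `U`. -/
noncomputable def gain [Fintype U] (G : WeightedBipartite U V) (M : V → Option U) : ℝ :=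
  ∑ u with ∃ v, M v = some u, G.weight u

/-- The largest gain of a matching (a maximum, see `opt_attained`). -/
noncomputable def opt [Fintype U] (G : WeightedBipartite U V) : ℝ :=
  ⨆ M : {M : V → Option U // G.IsMatching M}, G.gain M.1

theorem opt_attained [Fintype U] [Fintype V] (G : WeightedBipartite U V) :
    IsGreatest {g | ∃ M, G.IsMatching M ∧ G.gain M = g} G.opt := by
  have : Nonempty {M : V → Option U // G.IsMatching M} :=
    ⟨⟨fun _ => none, by simp, by simp⟩⟩
  constructor
  · obtain ⟨M, hM⟩ := exists_eq_ciSup_of_finite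
      (f := fun M : {M : V → Option U // G.IsMatching M} => G.gain M.1)
    exact ⟨M.1, M.2, hM⟩
  · rintro g ⟨M, hM, rfl⟩
    exact le_ciSup (f := fun M : {M : V → Option U // G.IsMatching M} => G.gain M.1)
      (Set.finite_range _).bddAbove ⟨M, hM⟩

open Classical in
/-- The neighbours of `v` that are unmatched in the current matching `M`. -/
noncomputable def available [Fintype U] (G : WeightedBipartite U V) (M : V → Option U) (v : V) :
    Finset U :=
  {u | G.adj u v ∧ ∀ w, M w ≠ some u}

/-- The perturbation function. -/
noncomputable def psi (x : ℝ) : ℝ := 1 - Real.exp (-(1 - x))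

open Classical in
/-- An element of `S` with the highest key, if `S` is not empty
(it is unique when `key` is injective). -/
noncomputable def pickMax {K : Type*} [LinearOrder K] (S : Finset U) (key : U → K) : Option U :=
  if h : S.Nonempty then some (S.exists_max_image key h).choose else none

open Classical in
/-- Processing the arrival of `v`: match it to the unmatched neighbour `u` with the highest
perturbed weight `weight u * psi (x u)`, ties being broken by the vertex identifier `vid`;
leave it unmatched if it has no unmatched neighbour. -/
noncomputable def greedyStep [Fintype U] (G : WeightedBipartite U V) (vid : U → ℕ) (x : U → ℝ)
    (M : V → Option U) (v : V) : V → Option U :=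
  Function.update M v
    (pickMax (G.available M v) fun u => toLex (G.weight u * psi (x u), vid u))

/-- The matching produced by Perturbed-Greedy with seeds `x`, when the online vertices arrive in
the order `π 0, π 1, …, π (m - 1)`. -/
noncomputable def perturbedGreedy [Fintype U] (G : WeightedBipartite U V) (vid : U → ℕ)
    {m : ℕ} (π : Fin m ≃ V) (x : U → ℝ) : V → Option U :=
  (List.ofFn π).foldl (G.greedyStep vid x) fun _ => none

end WeightedBipartite

/-- The law of a family of independent seeds, each uniform on `[0, 1]`. -/
noncomputable def uniformSeeds (U : Type*) [Fintype U] : MeasureTheory.Measure (U → ℝ) :=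
  MeasureTheory.Measure.pi fun _ => MeasureTheory.volume.restrict (Set.Icc (0 : ℝ) 1)

/-! ### Budgeted allocation -/

/-- An instance of budgeted allocation: budgets `B i` and bids `b i j`. -/
structure BudgetedAllocation (Agent Item : Type*) where
  budget : Agent → ℝ
  bid : Agent → Item → ℝ
  budget_nonneg : ∀ i, 0 ≤ budget i
  bid_nonneg : ∀ i j, 0 ≤ bid i j

namespace BudgetedAllocation

variable {Agent Item : Type*}

open Classical in
/-- The total revenue of an allocation; `a j = none` means that item `j` is given to nobody.
Agent `i` pays the minimum of the budget and the sum of the bids on the items received. -/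
noncomputable def revenue [Fintype Agent] [Fintype Item] (A : BudgetedAllocation Agent Item)
    (a : Item → Option Agent) : ℝ :=
  ∑ i, min (A.budget i) (∑ j with a j = some i, A.bid i j)

/-- The largest revenue of an allocation (a maximum, see `opt_attained`). -/
noncomputable def opt [Fintype Agent] [Fintype Item] (A : BudgetedAllocation Agent Item) : ℝ :=
  ⨆ a : Item → Option Agent, A.revenue a

theorem opt_attained [Fintype Agent] [Fintype Item] (A : BudgetedAllocation Agent Item) :
    IsGreatest (Set.range A.revenue) A.opt := by
  constructor
  · exact exists_eq_ciSup_of_finite (f := A.revenue)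
  · rintro g ⟨a, rfl⟩
    exact le_ciSup (Set.finite_range _).bddAbove a

/-- The single bids case: every bid of agent `i` is either `b i > 0` or zero. -/
def SingleBids (A : BudgetedAllocation Agent Item) (b : Agent → ℝ) : Prop :=
  (∀ i, 0 < b i) ∧ ∀ i j, A.bid i j = b i ∨ A.bid i j = 0

/-- The largest `n` with `n * b i ≤ B i`. -/
noncomputable def copies (A : BudgetedAllocation Agent Item) (b : Agent → ℝ) (i : Agent) : ℕ :=
  ⌊A.budget i / b i⌋₊

/-- The part of the budget that is left over by the full copies. -/
noncomputable def remainder (A : BudgetedAllocation Agent Item) (b : Agent → ℝ) (i : Agent) : ℝ :=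
  A.budget i - A.copies b i * b i

/-- The offline vertices that stand for the agents: `copies i` full vertices for each agent `i`,
and one more vertex if the remainder is positive. -/
def Copy (A : BudgetedAllocation Agent Item) (b : Agent → ℝ) : Type _ :=
  (Σ i, Fin (A.copies b i)) ⊕ {i // 0 < A.remainder b i}

open Classical in
noncomputable instance [Fintype Agent] (A : BudgetedAllocation Agent Item) (b : Agent → ℝ) :
    Fintype (A.Copy b) :=
  inferInstanceAs (Fintype ((Σ i, Fin (A.copies b i)) ⊕ {i // 0 < A.remainder b i}))

/-- The agent that an offline vertex stands for. -/
def owner (A : BudgetedAllocation Agent Item) (b : Agent → ℝ) : A.Copy b → Agent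
  | Sum.inl p => p.1
  | Sum.inr i => i.1

/-- The weight of an offline vertex: the bid value for a full vertex, the remainder otherwise. -/
noncomputable def copyWeight (A : BudgetedAllocation Agent Item) (b : Agent → ℝ) : A.Copy b → ℝ
  | Sum.inl p => b p.1
  | Sum.inr i => A.remainder b i.1

/-- The instance of vertex-weighted matching that belongs to a single-bids instance. -/
noncomputable def toMatching (A : BudgetedAllocation Agent Item) (b : Agent → ℝ) :
    WeightedBipartite (A.Copy b) Item where
  adj u j := A.bid (A.owner b u) j ≠ 0
  weight := A.copyWeight b

/-- The allocation that belongs to a matching: an item that is matched to a vertex of agent `i`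
goes to agent `i`. -/
def allocationOf (A : BudgetedAllocation Agent Item) (b : Agent → ℝ)
    (M : Item → Option (A.Copy b)) : Item → Option Agent :=
  fun j => (M j).map (A.owner b)

/-- Perturbed-Greedy for the single bids case, the items arriving in the order
`π 0, π 1, …, π (m - 1)`. -/
noncomputable def perturbedGreedy [Fintype Agent] (A : BudgetedAllocation Agent Item)
    (b : Agent → ℝ) (vid : A.Copy b → ℕ) {m : ℕ} (π : Fin m ≃ Item) (x : A.Copy b → ℝ) :
    Item → Option Agent :=
  A.allocationOf b ((A.toMatching b).perturbedGreedy vid π x)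

end BudgetedAllocation

/-! The ratio for matching comes from a randomized primal-dual argument. If `u` is matched, its
weight `w` splits into an offline share `w * exp (x u - 1)` and an online share `w * psi (x u)`,
credited to its partner. For any edge `u v`, the expected shares of `u` and `v` together are at
least `(1 - 1/e) * w`. Since the edges of an optimal matching are disjoint, summing over them gives
the bound for the expected gain (`competitive_greedyRun`).

For one edge, fix all seeds except that of `u`, and let `β` be the online share of `v` when `u` is
isolated. Restoring `u` with any seed `t` leaves `v` at least `β` (`partnerValue_isolate_le`), and
`u` is matched whenever `w * psi t > β` (`matched_of_partnerValue_isolate_lt`). Integrating over `t`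
gives the constant (`threshold_integral_bound`).

The reduction loses nothing. The copies of an agent have total weight equal to the budget and each
weighs at most the bid, so gain is at most revenue (`gain_le_revenue`). Conversely, filling the full
copies before the remainder copy turns an allocation into a matching of no smaller gain
(`exists_matching_revenue_le`). -/

namespace WeightedBipartite

/-! ### Greedy choices and runs on a list of arrivals. -/

variable {U V : Type*}

theorem pickMax_spec {K : Type*} [LinearOrder K] {S : Finset U} {key : U → K} {u : U}
    (h : pickMax S key = some u) : u ∈ S ∧ ∀ w ∈ S, key w ≤ key u := by
  unfold pickMax at h
  split_ifs at h with hS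
  cases h
  exact (S.exists_max_image key hS).choose_spec

theorem exists_pickMax_eq_some {K : Type*} [LinearOrder K] {S : Finset U} (key : U → K) {u : U}
    (h : u ∈ S) : ∃ p, pickMax S key = some p := by
  have hS : S.Nonempty := ⟨u, h⟩
  exact ⟨_, by rw [pickMax, dif_pos hS]⟩

theorem pickMax_eq_some_iff {K : Type*} [LinearOrder K] {S : Finset U} {key : U → K}
    (hkey : Function.Injective key) {u : U} :
    pickMax S key = some u ↔ u ∈ S ∧ ∀ w ∈ S, key w ≤ key u := by
  refine ⟨pickMax_spec, fun ⟨hu, hmax⟩ => ?_⟩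
  obtain ⟨p, hp⟩ := exists_pickMax_eq_some key hu
  obtain ⟨hpS, hpmax⟩ := pickMax_spec hp
  rw [hp, hkey (le_antisymm (hmax p hpS) (hpmax u hu))]

theorem pickMax_eq_none_iff {K : Type*} [LinearOrder K] {S : Finset U} {key : U → K} :
    pickMax S key = none ↔ S = ∅ := by
  unfold pickMax
  split_ifs with hS
  · simpa using hS.ne_empty
  · simpa using hS

theorem psi_nonneg {x : ℝ} (hx : x ≤ 1) : 0 ≤ psi x := by
  unfold psi
  have : Real.exp (-(1 - x)) ≤ 1 := Real.exp_le_one_iff.2 (by linarith)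
  linarith

theorem measurable_psi : Measurable psi := by
  unfold psi
  fun_prop

/-- The perturbed weight of an offline vertex, followed by its identifier. -/
noncomputable def key (G : WeightedBipartite U V) (vid : U → ℕ) (x : U → ℝ) (u : U) : ℝ ×ₗ ℕ :=
  toLex (G.weight u * psi (x u), vid u)

theorem key_injective (G : WeightedBipartite U V) {vid : U → ℕ} (hvid : Function.Injective vid)
    (x : U → ℝ) : Function.Injective (G.key vid x) := fun _ _ h =>
  hvid (congrArg (fun k => (ofLex k).2) h)

theorem key_le_key {G : WeightedBipartite U V} {vid : U → ℕ} {x : U → ℝ} {u w : U} :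
    G.key vid x u ≤ G.key vid x w ↔ G.weight u * psi (x u) < G.weight w * psi (x w) ∨
      G.weight u * psi (x u) = G.weight w * psi (x w) ∧ vid u ≤ vid w := by
  simp [key, Prod.Lex.toLex_le_toLex]

theorem perturbed_le_of_key_le {G : WeightedBipartite U V} {vid : U → ℕ} {x : U → ℝ} {u w : U}
    (h : G.key vid x u ≤ G.key vid x w) :
    G.weight u * psi (x u) ≤ G.weight w * psi (x w) := by
  rcases key_le_key.1 h with h | h
  exacts [h.le, h.1.le]

theorem exists_update_eq_some [DecidableEq V] {M : V → Option U} {v : V} (hv : M v = none)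
    (p : Option U) (u : U) :
    (∃ w, Function.update M v p w = some u) ↔ (∃ w, M w = some u) ∨ p = some u := by
  constructor
  · rintro ⟨w, hw⟩
    by_cases h : w = v
    · subst h
      simp at hw
      exact Or.inr hw
    · rw [Function.update_of_ne h] at hw
      exact Or.inl ⟨w, hw⟩
  · rintro (⟨w, hw⟩ | h)
    · refine ⟨w, ?_⟩
      rw [Function.update_of_ne, hw]
      rintro rfl
      simp [hv] at hw
    · exact ⟨v, by simpa using h⟩

/-- The graph without the edges at `u₀`. -/
def isolate (G : WeightedBipartite U V) (u₀ : U) : WeightedBipartite U V where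
  adj u v := u ≠ u₀ ∧ G.adj u v
  weight := G.weight

theorem key_isolate {G : WeightedBipartite U V} {vid : U → ℕ} {x y : U → ℝ} {u₀ : U}
    (hxy : ∀ u, u ≠ u₀ → x u = y u) {u : U} (hu : u ≠ u₀) :
    (G.isolate u₀).key vid y u = G.key vid x u := by
  simp [key, isolate, hxy u hu]

/-- The perturbed weight of the partner of `v`, or zero if `v` is unmatched. -/
noncomputable def partnerValue (G : WeightedBipartite U V) (x : U → ℝ) (M : V → Option U) (v : V) :
    ℝ :=
  (M v).elim 0 fun u => G.weight u * psi (x u)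

theorem partnerValue_nonneg {G : WeightedBipartite U V} {x : U → ℝ} (hw : ∀ u, 0 ≤ G.weight u)
    (hx : ∀ u, x u ≤ 1) (M : V → Option U)
    (v : V) : 0 ≤ G.partnerValue x M v := by
  unfold partnerValue
  cases M v with
  | none => exact le_rfl
  | some u => exact mul_nonneg (hw u) (psi_nonneg (hx u))

variable [Fintype U]

theorem mem_available {G : WeightedBipartite U V} {M : V → Option U} {v : V} {u : U} :
    u ∈ G.available M v ↔ G.adj u v ∧ ¬ ∃ w, M w = some u := by
  simp [available]

/-- The vertex to which Perturbed-Greedy matches `v` if the current matching is `M`. -/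
noncomputable def greedyChoice (G : WeightedBipartite U V) (vid : U → ℕ) (x : U → ℝ)
    (M : V → Option U) (v : V) : Option U :=
  pickMax (G.available M v) (G.key vid x)

/-- The matching of Perturbed-Greedy after the arrival of the vertices of the list `l`. -/
noncomputable def greedyRun (G : WeightedBipartite U V) (vid : U → ℕ) (x : U → ℝ) (l : List V) :
    V → Option U :=
  l.foldl (G.greedyStep vid x) fun _ => none

section Run

variable {G : WeightedBipartite U V} {vid : U → ℕ} {x : U → ℝ}

open Classical in
theorem greedyRun_concat (l : List V) (v : V) : G.greedyRun vid x (l ++ [v]) =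
    Function.update (G.greedyRun vid x l) v
      (G.greedyChoice vid x (G.greedyRun vid x l) v) := by
  simp only [greedyRun, List.foldl_append, List.foldl_cons, List.foldl_nil]
  rfl

theorem greedyRun_of_notMem {l : List V} {v : V} (hv : v ∉ l) :
    G.greedyRun vid x l v = none := by
  classical
  induction l using List.reverseRecOn with
  | nil => rfl
  | append_singleton l w ih =>
    simp only [List.mem_append, List.mem_singleton, not_or] at hv
    rw [greedyRun_concat, Function.update_of_ne hv.2, ih hv.1]

theorem greedyRun_append_of_notMem (l₁ : List V) {l₂ : List V} {v : V} (hv : v ∉ l₂) :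
    G.greedyRun vid x (l₁ ++ l₂) v = G.greedyRun vid x l₁ v := by
  classical
  induction l₂ using List.reverseRecOn with
  | nil => simp
  | append_singleton l w ih =>
    simp only [List.mem_append, List.mem_singleton, not_or] at hv
    rw [← List.append_assoc, greedyRun_concat, Function.update_of_ne hv.2, ih hv.1]

/-- Decisions are irrevocable: only the arrival of `v` itself writes to the entry of `v`. -/
theorem greedyRun_arrival {l₁ l₂ : List V} {v : V} (hv : v ∉ l₂) :
    G.greedyRun vid x (l₁ ++ v :: l₂) v =
      G.greedyChoice vid x (G.greedyRun vid x l₁) v := by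
  classical
  rw [← List.singleton_append, ← List.append_assoc, greedyRun_append_of_notMem _ hv,
    greedyRun_concat, Function.update_self]

theorem matched_greedyRun_concat {l : List V} {v : V} (hv : v ∉ l) (u : U) :
    (∃ w, G.greedyRun vid x (l ++ [v]) w = some u) ↔ (∃ w, G.greedyRun vid x l w = some u) ∨
      G.greedyChoice vid x (G.greedyRun vid x l) v = some u := by
  classical
  rw [greedyRun_concat, exists_update_eq_some (greedyRun_of_notMem hv)]

theorem matched_greedyRun_append {l₁ l₂ : List V} (h : (l₁ ++ l₂).Nodup) {u : U}
    (hu : ∃ w, G.greedyRun vid x l₁ w = some u) :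
    ∃ w, G.greedyRun vid x (l₁ ++ l₂) w = some u := by
  obtain ⟨w, hw⟩ := hu
  refine ⟨w, ?_⟩
  rw [greedyRun_append_of_notMem, hw]
  intro hw₂
  rw [greedyRun_of_notMem fun hw₁ => (List.nodup_append.1 h).2.2 w hw₁ w hw₂ rfl] at hw
  cases hw

theorem greedyChoice_spec {M : V → Option U} {v : V} {u : U}
    (h : G.greedyChoice vid x M v = some u) :
    G.adj u v ∧ (¬ ∃ w, M w = some u) ∧
      ∀ q, G.adj q v → (¬ ∃ w, M w = some q) → G.key vid x q ≤ G.key vid x u := by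
  obtain ⟨hu, hmax⟩ := pickMax_spec h
  rw [mem_available] at hu
  exact ⟨hu.1, hu.2, fun q hq hq' => hmax q (mem_available.2 ⟨hq, hq'⟩)⟩

theorem exists_greedyChoice_eq_some {M : V → Option U} {v : V} {u : U} (hadj : G.adj u v)
    (hu : ¬ ∃ w, M w = some u) : ∃ p, G.greedyChoice vid x M v = some p :=
  exists_pickMax_eq_some _ (mem_available.2 ⟨hadj, hu⟩)

theorem isMatching_greedyRun (l : List V) : G.IsMatching (G.greedyRun vid x l) := by
  classical
  induction l using List.reverseRecOn with
  | nil => exact ⟨by simp [greedyRun], by simp [greedyRun]⟩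
  | append_singleton l v ih =>
    rw [greedyRun_concat]
    constructor
    · intro w u hw
      by_cases h : w = v
      · subst h
        rw [Function.update_self] at hw
        exact (greedyChoice_spec hw).1
      · rw [Function.update_of_ne h] at hw
        exact ih.1 w u hw
    · intro w₁ w₂ u h₁ h₂
      by_cases e₁ : w₁ = v <;> by_cases e₂ : w₂ = v
      · rw [e₁, e₂]
      · subst e₁
        rw [Function.update_self] at h₁
        rw [Function.update_of_ne e₂] at h₂
        exact ((greedyChoice_spec h₁).2.1 ⟨w₂, h₂⟩).elim
      · subst e₂
        rw [Function.update_self] at h₂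
        rw [Function.update_of_ne e₁] at h₁
        exact ((greedyChoice_spec h₂).2.1 ⟨w₁, h₁⟩).elim
      · rw [Function.update_of_ne e₁] at h₁
        rw [Function.update_of_ne e₂] at h₂
        exact ih.2 w₁ w₂ u h₁ h₂

end Run

/-! ### Comparison with the run in which one offline vertex is isolated. -/

section Isolate

variable {G : WeightedBipartite U V} {vid : U → ℕ} {x y : U → ℝ} {u₀ : U}

/-- Isolating `u₀` does not enlarge the set of the other unmatched vertices, and it does not change
this set as long as `u₀` is unmatched. -/
theorem matched_isolate (hvid : Function.Injective vid) (hxy : ∀ u, u ≠ u₀ → x u = y u)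
    {l : List V} (hl : l.Nodup) :
    (∀ u, u ≠ u₀ → (∃ w, G.greedyRun vid x l w = some u) →
      ∃ w, (G.isolate u₀).greedyRun vid y l w = some u) ∧
    ((¬ ∃ w, G.greedyRun vid x l w = some u₀) → ∀ u,
      (∃ w, (G.isolate u₀).greedyRun vid y l w = some u) →
        ∃ w, G.greedyRun vid x l w = some u) := by
  induction l using List.reverseRecOn with
  | nil => simp [greedyRun]
  | append_singleton l v ih =>
    have hv : v ∉ l := by
      intro h
      exact (List.nodup_append.1 hl).2.2 v h v (by simp) rfl
    obtain ⟨ih₁, ih₂⟩ := ih (List.nodup_append.1 hl).1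
    simp only [matched_greedyRun_concat hv]
    constructor
    · rintro u hu (h | h)
      · exact Or.inl (ih₁ u hu h)
      -- If the isolated run prefers some `p` to the free vertex `u`, then `p` is free in the full
      -- run as well, where `u` was preferred. Each key bounds the other, so `p = u` by injectivity.
      · by_contra! hcon
        obtain ⟨hadj, hun, hmax⟩ := greedyChoice_spec h
        have hNu : ¬ ∃ w, (G.isolate u₀).greedyRun vid y l w = some u := by
          simpa using hcon.1
        obtain ⟨p, hp⟩ := exists_greedyChoice_eq_some (G := G.isolate u₀) (vid := vid) (x := y)
          (v := v) ⟨hu, hadj⟩ hNu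
        obtain ⟨hpadj, hpun, hpmax⟩ := greedyChoice_spec hp
        have h1 := hpmax u ⟨hu, hadj⟩ hNu
        rw [key_isolate hxy hu, key_isolate hxy hpadj.1] at h1
        have h2 := hmax p hpadj.2 fun h => hpun (ih₁ p hpadj.1 h)
        have := G.key_injective hvid x (le_antisymm h1 h2)
        exact hcon.2 (this ▸ hp)
    · rintro hu₀ u (h | h)
      · exact Or.inl (ih₂ (fun h => hu₀ (Or.inl h)) u h)
      · obtain ⟨hadj, hun, hmax⟩ := greedyChoice_spec h
        by_contra! hcon
        have hGu : ¬ ∃ w, G.greedyRun vid x l w = some u := by simpa using hcon.1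
        obtain ⟨p, hp⟩ := exists_greedyChoice_eq_some (G := G) (vid := vid) (x := x)
          (v := v) hadj.2 hGu
        obtain ⟨hpadj, hpun, hpmax⟩ := greedyChoice_spec hp
        -- This is where `u₀` staying unmatched enters: the choice of the full run is then also
        -- admissible in the isolated run, and the two choices agree as before.
        have hpu : p ≠ u₀ := by
          rintro rfl
          exact hu₀ (Or.inr hp)
        have h1 := hpmax u hadj.2 hGu
        have h2 := hmax p ⟨hpu, hpadj⟩ fun h => hpun (ih₂ (fun h => hu₀ (Or.inl h)) p h)
        rw [key_isolate hxy hadj.1, key_isolate hxy hpu] at h2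
        have := G.key_injective hvid x (le_antisymm h1 h2)
        exact hcon.2 (this ▸ hp)

/-- When `v` arrives, the vertex chosen in the isolated run is still free in the full run, by the
first half of `matched_isolate`, so the full run chooses something at least as good. -/
theorem partnerValue_isolate_le (hvid : Function.Injective vid) (hw : ∀ u, 0 ≤ G.weight u)
    (hx : ∀ u, x u ≤ 1) (hxy : ∀ u, u ≠ u₀ → x u = y u) {l : List V} (hl : l.Nodup) {v : V}
    (hv : v ∈ l) :
    (G.isolate u₀).partnerValue y ((G.isolate u₀).greedyRun vid y l) v ≤
      G.partnerValue x (G.greedyRun vid x l) v := by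
  obtain ⟨l₁, l₂, rfl⟩ := List.append_of_mem hv
  have hl₁ := (List.nodup_append.1 hl).1
  have hv₂ : v ∉ l₂ := (List.nodup_cons.1 (List.nodup_append.1 hl).2.1).1
  cases hp : (G.isolate u₀).greedyRun vid y (l₁ ++ v :: l₂) v with
  | none =>
    have := partnerValue_nonneg hw hx (G.greedyRun vid x (l₁ ++ v :: l₂)) v
    simpa [partnerValue, hp] using this
  | some p =>
    have hp' := hp
    rw [greedyRun_arrival hv₂] at hp'
    obtain ⟨hpadj, hpun, -⟩ := greedyChoice_spec hp'
    have hGp : ¬ ∃ w, G.greedyRun vid x l₁ w = some p := fun h =>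
      hpun ((matched_isolate hvid hxy hl₁).1 p hpadj.1 h)
    obtain ⟨q, hq⟩ := exists_greedyChoice_eq_some (G := G) (vid := vid) (x := x) hpadj.2 hGp
    have h := perturbed_le_of_key_le ((greedyChoice_spec hq).2.2 p hpadj.2 hGp)
    simp only [partnerValue, hp, greedyRun_arrival hv₂, hq, Option.elim_some]
    rwa [← hxy p hpadj.1]

/-- If `u₀` stayed unmatched, `v` would have preferred some other `q` to it. By the second half of
`matched_isolate`, `q` is free in the isolated run too, so the partner of `v` there is worth at
least as much as `u₀`. -/
theorem matched_of_partnerValue_isolate_lt (hvid : Function.Injective vid)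
    (hxy : ∀ u, u ≠ u₀ → x u = y u) {l : List V} (hl : l.Nodup) {v : V}
    (hv : v ∈ l) (hadj : G.adj u₀ v)
    (hlt : (G.isolate u₀).partnerValue y ((G.isolate u₀).greedyRun vid y l) v <
      G.weight u₀ * psi (x u₀)) :
    ∃ w, G.greedyRun vid x l w = some u₀ := by
  obtain ⟨l₁, l₂, rfl⟩ := List.append_of_mem hv
  have hl₁ := (List.nodup_append.1 hl).1
  have hv₂ : v ∉ l₂ := (List.nodup_cons.1 (List.nodup_append.1 hl).2.1).1
  by_contra hcon
  have hun : ¬ ∃ w, G.greedyRun vid x l₁ w = some u₀ := fun h =>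
    hcon (matched_greedyRun_append hl h)
  obtain ⟨q, hq⟩ := exists_greedyChoice_eq_some (G := G) (vid := vid) (x := x) hadj hun
  obtain ⟨hqadj, hqun, hqmax⟩ := greedyChoice_spec hq
  have hqu : q ≠ u₀ := by
    rintro rfl
    exact hcon ⟨v, by rw [greedyRun_arrival hv₂, hq]⟩
  have hNq : ¬ ∃ w, (G.isolate u₀).greedyRun vid y l₁ w = some q := fun h =>
    hqun ((matched_isolate hvid hxy hl₁).2 hun q h)
  obtain ⟨p, hp⟩ := exists_greedyChoice_eq_some (G := G.isolate u₀) (vid := vid) (x := y) (v := v)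
    ⟨hqu, hqadj⟩ hNq
  obtain ⟨hpadj, -, hpmax⟩ := greedyChoice_spec hp
  have h1 := perturbed_le_of_key_le (hqmax u₀ hadj hun)
  have h2 := hpmax q ⟨hqu, hqadj⟩ hNq
  have h3 := perturbed_le_of_key_le h2
  simp only [partnerValue, greedyRun_arrival hv₂, hp, Option.elim_some] at hlt
  rw [← hxy q hqu] at h3
  exact absurd (h1.trans h3) (not_le.2 hlt)

end Isolate

end WeightedBipartite

/-! ### Uniform seeds, redrawing one seed, and the threshold integral. -/

open MeasureTheory in
theorem integrable_of_bound_ae {Ω : Type*} [MeasurableSpace Ω] {μ : Measure Ω} [IsFiniteMeasure μ]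
    {f : Ω → ℝ} (hf : Measurable f) {C : ℝ} (h : ∀ᵐ x ∂μ, |f x| ≤ C) : Integrable f μ :=
  Integrable.of_bound hf.aestronglyMeasurable C (by simpa using h)

/-- Meant for `R` the matching of the greedy run, which takes finitely many values: on each level
set the shares are explicit functions of the seeds. -/
theorem measurable_of_measurableSet_fibers {Ω S β : Type*} [MeasurableSpace Ω]
    [MeasurableSpace β] [Finite S] {R : Ω → S} (hR : ∀ s, MeasurableSet {x | R x = s})
    {F : S → Ω → β} (hF : ∀ s, Measurable (F s)) : Measurable fun x => F (R x) x := by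
  intro t ht
  have : (fun x => F (R x) x) ⁻¹' t = ⋃ s, {x | R x = s} ∩ F s ⁻¹' t := by
    ext x
    simp
  rw [this]
  exact MeasurableSet.iUnion fun s => (hR s).inter (hF s ht)

section UniformSeeds

open MeasureTheory

variable {U : Type*} [Fintype U]

instance isProbabilityMeasure_restrict_unitInterval :
    IsProbabilityMeasure (volume.restrict (Set.Icc (0 : ℝ) 1)) :=
  ⟨by simp⟩

instance isProbabilityMeasure_uniformSeeds : IsProbabilityMeasure (uniformSeeds U) := by
  unfold uniformSeeds
  infer_instance

theorem ae_mem_Icc_uniformSeeds : ∀ᵐ x ∂uniformSeeds U, ∀ u, x u ∈ Set.Icc (0 : ℝ) 1 := by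
  refine ae_all_iff.2 fun u => ?_
  exact Measure.tendsto_eval_ae_ae.eventually (ae_restrict_mem measurableSet_Icc)

/-- Drawing one seed again does not change the law of the seeds. -/
theorem measurePreserving_update_uniformSeeds [DecidableEq U] (u : U) :
    MeasurePreserving (fun p : (U → ℝ) × ℝ => Function.update p.1 u p.2)
      ((uniformSeeds U).prod (volume.restrict (Set.Icc (0 : ℝ) 1))) (uniformSeeds U) := by
  have hmeas : Measurable fun p : (U → ℝ) × ℝ => Function.update p.1 u p.2 :=
    measurable_pi_lambda _ fun i => by
      by_cases h : i = u
      · subst h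
        simpa using measurable_snd
      · simp only [Function.update_of_ne h]
        exact (measurable_pi_apply i).comp measurable_fst
  refine ⟨hmeas, ?_⟩
  symm
  refine Measure.pi_eq fun s hs => ?_
  rw [Measure.map_apply hmeas (MeasurableSet.univ_pi hs)]
  -- The old coordinate `u` is discarded, so its side becomes the whole line, of measure one; the
  -- redrawn coordinate supplies the factor `s u`.
  have : (fun p : (U → ℝ) × ℝ => Function.update p.1 u p.2) ⁻¹' Set.univ.pi s =
      (Set.univ.pi (Function.update s u Set.univ)) ×ˢ s u := by
    ext ⟨x, t⟩
    simp only [Set.mem_preimage, Set.mem_pi, Set.mem_univ, true_imp_iff, Set.mem_prod]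
    constructor
    · intro h
      refine ⟨fun i => ?_, by simpa using h u⟩
      by_cases hi : i = u
      · subst hi
        simp
      · simpa [hi] using h i
    · rintro ⟨h, ht⟩ i
      by_cases hi : i = u
      · subst hi
        simpa using ht
      · simpa [hi] using h i
  rw [this, Measure.prod_prod, uniformSeeds, Measure.pi_pi, mul_comm,
    ← Finset.mul_prod_erase Finset.univ (fun i => volume.restrict (Set.Icc (0 : ℝ) 1) (s i))
      (Finset.mem_univ u),
    ← Finset.mul_prod_erase Finset.univ
      (fun i => volume.restrict (Set.Icc (0 : ℝ) 1) (Function.update s u Set.univ i))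
      (Finset.mem_univ u)]
  simp only [Function.update_self, measure_univ, one_mul]
  congr 1
  refine Finset.prod_congr rfl fun i hi => ?_
  rw [Function.update_of_ne (Finset.ne_of_mem_erase hi)]

/-- Fubini after redrawing seed `u`: a bound on the average over that seed, for almost all values of
the others, passes to the expectation. -/
theorem le_integral_uniformSeeds_of_le_update [DecidableEq U] {f : (U → ℝ) → ℝ}
    (hf : Integrable f (uniformSeeds U)) (u : U) {c : ℝ}
    (h : ∀ᵐ x ∂uniformSeeds U, c ≤ ∫ t in Set.Icc (0 : ℝ) 1, f (Function.update x u t)) :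
    c ≤ ∫ x, f x ∂uniformSeeds U := by
  have hp := measurePreserving_update_uniformSeeds u
  have hint : Integrable (fun p : (U → ℝ) × ℝ => f (Function.update p.1 u p.2))
      ((uniformSeeds U).prod (volume.restrict (Set.Icc (0 : ℝ) 1))) :=
    hp.integrable_comp_of_integrable hf
  have hfm : AEStronglyMeasurable f (Measure.map (fun p : (U → ℝ) × ℝ => Function.update p.1 u p.2)
      ((uniformSeeds U).prod (volume.restrict (Set.Icc (0 : ℝ) 1)))) := by
    rw [hp.map_eq]
    exact hf.1
  rw [← hp.map_eq, integral_map hp.measurable.aemeasurable hfm, integral_prod _ hint]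
  calc c = ∫ _x, c ∂uniformSeeds U := by simp
    _ ≤ _ := integral_mono_ae (integrable_const c) hint.integral_prod_left h

/-- The seeds below the threshold at which the perturbed weight drops to `β` make up for `β` being
small. -/
theorem threshold_integral_bound {w β : ℝ} (hβ : 0 ≤ β) (hw : 0 ≤ w) {f : ℝ → ℝ}
    (hf : IntegrableOn f (Set.Icc 0 1))
    (h1 : ∀ t ∈ Set.Icc (0 : ℝ) 1, β ≤ f t)
    (h2 : ∀ t ∈ Set.Icc (0 : ℝ) 1, β < w * WeightedBipartite.psi t →
      β + w * Real.exp (t - 1) ≤ f t) :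
    (1 - 1 / Real.exp 1) * w ≤ ∫ t in Set.Icc (0 : ℝ) 1, f t := by
  rw [one_div, ← Real.exp_neg]
  rcases le_or_gt ((1 - Real.exp (-1)) * w) β with hc | hc
  · calc (1 - Real.exp (-1)) * w ≤ β := hc
      _ = ∫ _t in Set.Icc (0 : ℝ) 1, β := by simp
      _ ≤ _ := setIntegral_mono_on (integrable_const β) hf measurableSet_Icc h1
  · have he : 0 < Real.exp (-1) := Real.exp_pos _
    have hwpos : 0 < w := by
      refine hw.lt_of_ne ?_
      rintro rfl
      simp at hc
      linarith
    have hq : Real.exp (-1) < 1 - β / w := by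
      have : β / w < 1 - Real.exp (-1) := (div_lt_iff₀ hwpos).2 hc
      linarith
    have hq0 : 0 < 1 - β / w := he.trans hq
    -- The threshold solves `w * psi y = β`; the case assumption `hc` is what places it in `[0, 1]`.
    set y := 1 + Real.log (1 - β / w) with hy
    have hy0 : 0 ≤ y := by
      have := (Real.lt_log_iff_exp_lt hq0).2 hq
      linarith
    have hy1 : y ≤ 1 := by
      have : Real.log (1 - β / w) ≤ 0 :=
        Real.log_nonpos hq0.le (by linarith [div_nonneg hβ hw])
      linarith
    have hey : Real.exp (y - 1) = 1 - β / w := by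
      rw [hy, add_sub_cancel_left, Real.exp_log hq0]
    -- The interval excludes `y`, since `h2` needs a strict inequality and `psi` is decreasing.
    have hmono : ∀ t ∈ Set.Icc (0 : ℝ) 1,
        β + (Set.Ico 0 y).indicator (fun t => w * Real.exp (t - 1)) t ≤ f t := by
      intro t ht
      by_cases hty : t ∈ Set.Ico 0 y
      · rw [Set.indicator_of_mem hty]
        refine h2 t ht ?_
        have : Real.exp (t - 1) < 1 - β / w := by
          rw [← hey]
          exact Real.exp_lt_exp.2 (by linarith [hty.2])
        have hψ : β / w < WeightedBipartite.psi t := by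
          rw [WeightedBipartite.psi, neg_sub]
          linarith
        rw [div_lt_iff₀ hwpos] at hψ
        linarith
      · rw [Set.indicator_of_notMem hty, add_zero]
        exact h1 t ht
    have hcont : Continuous fun t : ℝ => w * Real.exp (t - 1) := by fun_prop
    have hind : IntegrableOn ((Set.Ico 0 y).indicator fun t => w * Real.exp (t - 1))
        (Set.Icc (0 : ℝ) 1) :=
      (hcont.integrableOn_Icc).indicator measurableSet_Ico
    have hval : ∫ t in Set.Icc (0 : ℝ) 1,
        (Set.Ico 0 y).indicator (fun t => w * Real.exp (t - 1)) t =
          w * (Real.exp (y - 1) - Real.exp (-1)) := by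
      rw [setIntegral_indicator measurableSet_Ico,
        Set.inter_eq_right.2 (Set.Ico_subset_Icc_self.trans (Set.Icc_subset_Icc_right hy1)),
        integral_Ico_eq_integral_Ioc, ← intervalIntegral.integral_of_le hy0,
        intervalIntegral.integral_const_mul, intervalIntegral.integral_comp_sub_right,
        integral_exp, zero_sub]
    have hconst : IntegrableOn (fun _ : ℝ => β) (Set.Icc (0 : ℝ) 1) := integrable_const β
    -- Here `w * exp (y - 1) = w - β`, so `β` cancels.
    calc (1 - Real.exp (-1)) * w = β + w * (Real.exp (y - 1) - Real.exp (-1)) := by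
          rw [hey]
          field_simp
          ring
      _ = ∫ t in Set.Icc (0 : ℝ) 1,
            (β + (Set.Ico 0 y).indicator (fun t => w * Real.exp (t - 1)) t) := by
          rw [integral_add hconst hind, hval]
          simp
      _ ≤ _ := setIntegral_mono_on (hconst.add hind) hf measurableSet_Icc hmono

end UniformSeeds

/-! ### Measurability of the algorithm in the seeds. -/

namespace WeightedBipartite

open MeasureTheory

variable {U V : Type*} [Fintype U] {G : WeightedBipartite U V} {vid : U → ℕ}

omit [Fintype U] in
theorem measurableSet_key_le (G : WeightedBipartite U V) (vid : U → ℕ) (u w : U) :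
    MeasurableSet {x | G.key vid x u ≤ G.key vid x w} := by
  have hm : ∀ u, Measurable fun x : U → ℝ => G.weight u * psi (x u) := fun u =>
    (measurable_psi.comp (measurable_pi_apply u)).const_mul _
  simp only [key_le_key]
  exact (measurableSet_lt (hm u) (hm w)).union
    ((measurableSet_eq_fun (hm u) (hm w)).inter (MeasurableSet.const _))

/-- Distinct identifiers make the maximizer unique, so the choice is determined by finitely many key
comparisons. -/
theorem measurableSet_greedyChoice_eq (hvid : Function.Injective vid) (M : V → Option U) (v : V)
    (p : Option U) : MeasurableSet {x | G.greedyChoice vid x M v = p} := by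
  cases p with
  | none =>
    simp only [greedyChoice, pickMax_eq_none_iff]
    exact MeasurableSet.const _
  | some u =>
    simp only [greedyChoice, pickMax_eq_some_iff (G.key_injective hvid _)]
    have : {x | u ∈ G.available M v ∧ ∀ w ∈ G.available M v, G.key vid x w ≤ G.key vid x u} =
        {_x | u ∈ G.available M v} ∩
          ⋂ w ∈ G.available M v, {x | G.key vid x w ≤ G.key vid x u} := by
      ext x
      simp
    rw [this]
    exact (MeasurableSet.const _).inter
      (MeasurableSet.iInter fun w => MeasurableSet.iInter fun _ => measurableSet_key_le G vid w u)

theorem measurableSet_greedyRun_eq [Finite V] (hvid : Function.Injective vid) (l : List V)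
    (M : V → Option U) : MeasurableSet {x | G.greedyRun vid x l = M} := by
  classical
  induction l using List.reverseRecOn generalizing M with
  | nil => exact MeasurableSet.const ((fun _ => none) = M)
  | append_singleton l v ih =>
    -- Splitting by the previous matching `M'` makes the set of available vertices independent of
    -- the seeds.
    have : {x | G.greedyRun vid x (l ++ [v]) = M} =
        ⋃ M' : V → Option U, ⋃ p : Option U,
          ({x | G.greedyRun vid x l = M'} ∩ {x | G.greedyChoice vid x M' v = p}) ∩
            {_x | Function.update M' v p = M} := by
      ext x
      simp only [greedyRun_concat, Set.mem_ofPred_eq, Set.mem_iUnion, Set.mem_inter_iff]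
      constructor
      · intro h
        exact ⟨_, _, ⟨rfl, rfl⟩, h⟩
      · rintro ⟨M', p, ⟨rfl, rfl⟩, h⟩
        exact h
    rw [this]
    exact MeasurableSet.iUnion fun M' => MeasurableSet.iUnion fun p =>
      ((ih M').inter (measurableSet_greedyChoice_eq hvid M' v p)).inter (MeasurableSet.const _)

theorem integrable_comp_greedyRun [Finite V] (hvid : Function.Injective vid) (l : List V)
    (F : (V → Option U) → ℝ) :
    Integrable (fun x => F (G.greedyRun vid x l)) (uniformSeeds U) := by
  obtain ⟨C, hC⟩ := (Set.finite_range fun M => |F M|).bddAbove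
  refine integrable_of_bound_ae (C := C) (measurable_of_measurableSet_fibers
    (measurableSet_greedyRun_eq hvid l) (F := fun M _ => F M) fun M => measurable_const) ?_
  exact ae_of_all _ fun x => hC ⟨_, rfl⟩

/-! ### Splitting the gain into shares, and the competitive ratio for matching. -/

open Classical in
/-- The part of the weight of `u` that is charged to `u` if it is matched by `M`. -/
noncomputable def offlineShare (G : WeightedBipartite U V) (x : U → ℝ) (M : V → Option U) (u : U) :
    ℝ :=
  if ∃ w, M w = some u then G.weight u * Real.exp (x u - 1) else 0

omit [Fintype U] in
theorem offlineShare_nonneg (hw : ∀ u, 0 ≤ G.weight u) (x : U → ℝ) (M : V → Option U) (u : U) :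
    0 ≤ G.offlineShare x M u := by
  unfold offlineShare
  split_ifs
  · exact mul_nonneg (hw u) (Real.exp_pos _).le
  · exact le_rfl

/-- Double counting of the matched pairs. The decidability instance is arbitrary so that the lemma
fits any filter. -/
theorem sum_matched_eq_sum_partner [Fintype V] {M : V → Option U} (hM : G.IsMatching M)
    {_ : DecidablePred fun u => ∃ v, M v = some u} (c : U → ℝ) :
    ∑ u with ∃ v, M v = some u, c u = ∑ v, (M v).elim 0 c := by
  classical
  have h : ∀ v, (M v).elim 0 c = ∑ u, if M v = some u then c u else 0 := by
    intro v
    cases h : M v <;> simp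
  simp_rw [h]
  rw [Finset.sum_comm, Finset.sum_filter]
  refine Finset.sum_congr rfl fun u _ => ?_
  split_ifs with hu
  · obtain ⟨v, hv⟩ := hu
    rw [Finset.sum_eq_single v]
    · rw [if_pos hv]
    · intro w _ hwv
      exact if_neg fun hw => hwv (hM.2 w v u hw hv)
    · simp
  · push Not at hu
    exact (Finset.sum_eq_zero fun v _ => if_neg (hu v)).symm

theorem gain_eq_sum_partner [Fintype V] {M : V → Option U} (hM : G.IsMatching M) :
    G.gain M = ∑ v, (M v).elim 0 G.weight := by
  rw [gain]
  exact sum_matched_eq_sum_partner hM G.weight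

/-- The two shares of a matched pair add up to its weight because `exp (x - 1) + psi x = 1`. -/
theorem gain_eq_sum_shares [Fintype V] {M : V → Option U} (hM : G.IsMatching M) (x : U → ℝ) :
    G.gain M = ∑ u, G.offlineShare x M u + ∑ v, G.partnerValue x M v := by
  classical
  have h : ∑ u with ∃ v, M v = some u, G.weight u * psi (x u) =
      ∑ v, (M v).elim 0 fun u => G.weight u * psi (x u) :=
    sum_matched_eq_sum_partner hM _
  have h' : ∑ u, G.offlineShare x M u =
      ∑ u with ∃ v, M v = some u, G.weight u * Real.exp (x u - 1) := by
    rw [Finset.sum_filter]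
    refine Finset.sum_congr rfl fun u _ => ?_
    unfold offlineShare
    split_ifs <;> rfl
  simp only [partnerValue]
  rw [← h, h', ← Finset.sum_add_distrib, gain]
  refine Finset.sum_congr (by ext; simp) fun u _ => ?_
  rw [psi, neg_sub]
  ring

theorem edgeValue_integrable [Fintype V] (hvid : Function.Injective vid)
    (hw : ∀ u, 0 ≤ G.weight u) (l : List V) (u : U) (v : V) :
    Integrable (fun x => G.offlineShare x (G.greedyRun vid x l) u +
      G.partnerValue x (G.greedyRun vid x l) v) (uniformSeeds U) := by
  classical
  refine integrable_of_bound_ae (C := ∑ u, G.weight u) (measurable_of_measurableSet_fibers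
    (measurableSet_greedyRun_eq hvid l)
    (F := fun M x => G.offlineShare x M u + G.partnerValue x M v) fun M => ?_) ?_
  · refine Measurable.add ?_ ?_
    · unfold offlineShare
      split_ifs
      · fun_prop
      · exact measurable_const
    · unfold partnerValue
      cases M v with
      | none => exact measurable_const
      | some u => exact (measurable_psi.comp (measurable_pi_apply u)).const_mul _
  · filter_upwards [ae_mem_Icc_uniformSeeds] with x hx
    have h1 := offlineShare_nonneg hw x (G.greedyRun vid x l)
    have h2 := partnerValue_nonneg hw (fun u => (hx u).2) (G.greedyRun vid x l)
    rw [abs_of_nonneg (add_nonneg (h1 u) (h2 v))]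
    -- All shares are nonnegative and sum to the gain, which is at most the total weight.
    calc _ ≤ ∑ u, G.offlineShare x (G.greedyRun vid x l) u +
          ∑ v, G.partnerValue x (G.greedyRun vid x l) v :=
        add_le_add (Finset.single_le_sum (fun u _ => h1 u) (Finset.mem_univ u))
          (Finset.single_le_sum (fun v _ => h2 v) (Finset.mem_univ v))
      _ = G.gain (G.greedyRun vid x l) := (gain_eq_sum_shares (isMatching_greedyRun l) x).symm
      _ ≤ ∑ u, G.weight u :=
        Finset.sum_le_sum_of_subset_of_nonneg (Finset.subset_univ _) fun u _ _ => hw u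

/-- The expected dual value of an edge covers the fraction `1 - 1 / e` of the weight of its offline
endpoint. -/
theorem le_integral_edgeValue [Fintype V] (hvid : Function.Injective vid)
    (hw : ∀ u, 0 ≤ G.weight u) {l : List V} (hl : l.Nodup) {u : U} {v : V} (hv : v ∈ l)
    (hadj : G.adj u v) :
    (1 - 1 / Real.exp 1) * G.weight u ≤
      ∫ x, (G.offlineShare x (G.greedyRun vid x l) u +
        G.partnerValue x (G.greedyRun vid x l) v) ∂uniformSeeds U := by
  classical
  have hint := edgeValue_integrable hvid hw l u v
  have hp := measurePreserving_update_uniformSeeds u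
  refine le_integral_uniformSeeds_of_le_update hint u ?_
  filter_upwards [ae_mem_Icc_uniformSeeds, (hp.integrable_comp_of_integrable hint).prod_right_ae]
    with y hy hyint
  -- This value is fixed before seed `u` is redrawn, so it is a constant in the integral over `t`.
  set β := (G.isolate u).partnerValue y ((G.isolate u).greedyRun vid y l) v with hβ
  have hle : ∀ t ∈ Set.Icc (0 : ℝ) 1, ∀ i, Function.update y u t i ≤ 1 := by
    intro t ht i
    by_cases hi : i = u
    · subst hi
      simpa using ht.2
    · simpa [hi] using (hy i).2
  have hag : ∀ t : ℝ, ∀ i, i ≠ u → Function.update y u t i = y i := fun t i hi => by simp [hi]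
  have hβle : ∀ t ∈ Set.Icc (0 : ℝ) 1, β ≤ G.partnerValue (Function.update y u t)
      (G.greedyRun vid (Function.update y u t) l) v := fun t ht =>
    partnerValue_isolate_le hvid hw (hle t ht) (hag t) hl hv
  refine threshold_integral_bound (β := β)
    (partnerValue_nonneg (G := G.isolate u) hw (fun i => (hy i).2) _ _) (hw u) hyint ?_ ?_
  · intro t ht
    linarith [hβle t ht, offlineShare_nonneg hw (Function.update y u t)
      (G.greedyRun vid (Function.update y u t) l) u]
  · intro t ht hlt
    have hm : ∃ w, G.greedyRun vid (Function.update y u t) l w = some u :=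
      matched_of_partnerValue_isolate_lt hvid (hag t) hl hv hadj (by simpa using hlt)
    have hs : G.offlineShare (Function.update y u t)
        (G.greedyRun vid (Function.update y u t) l) u = G.weight u * Real.exp (t - 1) := by
      rw [offlineShare, if_pos hm, Function.update_self]
    rw [hs]
    linarith [hβle t ht]

/-- Perturbed-Greedy is `1 - 1 / e`-competitive for vertex-weighted bipartite matching. -/
theorem competitive_greedyRun [Fintype V] (hvid : Function.Injective vid)
    (hw : ∀ u, 0 ≤ G.weight u) {l : List V} (hl : l.Nodup) (hmem : ∀ v, v ∈ l) :
    (1 - 1 / Real.exp 1) * G.opt ≤ ∫ x, G.gain (G.greedyRun vid x l) ∂uniformSeeds U := by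
  classical
  obtain ⟨M, hM, hgain⟩ := G.opt_attained.1
  have hopt : G.opt = ∑ v, (M v).elim 0 G.weight := by
    rw [← hgain, gain_eq_sum_partner hM]
  have hedge : ∀ v, Integrable (fun x => (M v).elim 0 fun u =>
      G.offlineShare x (G.greedyRun vid x l) u + G.partnerValue x (G.greedyRun vid x l) v)
        (uniformSeeds U) := by
    intro v
    cases M v with
    | none => exact integrable_zero _ _ _
    | some u => exact edgeValue_integrable hvid hw l u v
  calc (1 - 1 / Real.exp 1) * G.opt
      = ∑ v, (1 - 1 / Real.exp 1) * (M v).elim 0 G.weight := by rw [hopt, Finset.mul_sum]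
    _ ≤ ∑ v, ∫ x, ((M v).elim 0 fun u => G.offlineShare x (G.greedyRun vid x l) u +
          G.partnerValue x (G.greedyRun vid x l) v) ∂uniformSeeds U := by
        refine Finset.sum_le_sum fun v _ => ?_
        cases h : M v with
        | none => simp
        | some u => exact le_integral_edgeValue hvid hw hl (hmem v) (hM.1 v u h)
    _ = ∫ x, ∑ v, ((M v).elim 0 fun u => G.offlineShare x (G.greedyRun vid x l) u +
          G.partnerValue x (G.greedyRun vid x l) v) ∂uniformSeeds U :=
        (integral_finsetSum _ fun v _ => hedge v).symm
    _ ≤ _ := by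
        refine integral_mono_ae (integrable_finsetSum _ fun v _ => hedge v)
          (integrable_comp_greedyRun hvid l G.gain) ?_
        filter_upwards [ae_mem_Icc_uniformSeeds] with x hx
        set N := G.greedyRun vid x l with hN
        have h1 := offlineShare_nonneg hw x N
        have h2 := partnerValue_nonneg hw (fun u => (hx u).2) N
        rw [gain_eq_sum_shares (isMatching_greedyRun l) x, ← hN]
        -- Each vertex lies on at most one edge of `M`, so no share is used twice; shares of
        -- vertices missed by `M` are nonnegative.
        calc ∑ v, ((M v).elim 0 fun u => G.offlineShare x N u + G.partnerValue x N v)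
            ≤ ∑ v, ((M v).elim 0 (G.offlineShare x N) + G.partnerValue x N v) := by
              refine Finset.sum_le_sum fun v _ => ?_
              cases M v with
              | none => simpa using h2 v
              | some u => exact le_rfl
          _ = ∑ u with ∃ v, M v = some u, G.offlineShare x N u + ∑ v, G.partnerValue x N v := by
              rw [Finset.sum_add_distrib, sum_matched_eq_sum_partner hM]
          _ ≤ _ := by
              gcongr
              · exact fun u _ _ => h1 u
              · exact Finset.subset_univ _

end WeightedBipartite

/-! ### The reduction from single bids to matching. -/

namespace BudgetedAllocation

open WeightedBipartite

variable {Agent Item : Type*} {A : BudgetedAllocation Agent Item} {b : Agent → ℝ}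

theorem remainder_nonneg (hb : A.SingleBids b) (i : Agent) : 0 ≤ A.remainder b i := by
  have h := Nat.floor_le (div_nonneg (A.budget_nonneg i) (hb.1 i).le)
  rw [le_div_iff₀ (hb.1 i)] at h
  exact sub_nonneg.2 h

theorem remainder_lt (hb : A.SingleBids b) (i : Agent) : A.remainder b i < b i := by
  have h := Nat.lt_floor_add_one (A.budget i / b i)
  rw [div_lt_iff₀ (hb.1 i)] at h
  unfold remainder copies
  linarith

theorem copyWeight_pos (hb : A.SingleBids b) (u : A.Copy b) : 0 < A.copyWeight b u := by
  rcases u with p | i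
  exacts [hb.1 p.1, i.2]

theorem copyWeight_le (hb : A.SingleBids b) (u : A.Copy b) :
    A.copyWeight b u ≤ b (A.owner b u) := by
  rcases u with p | i
  exacts [le_rfl, (remainder_lt hb i.1).le]

theorem bid_eq_of_ne_zero (hb : A.SingleBids b) {i : Agent} {j : Item} (h : A.bid i j ≠ 0) :
    A.bid i j = b i :=
  (hb.2 i j).resolve_right h

variable [Fintype Agent]

open Classical in
theorem sum_copy (f : A.Copy b → ℝ) : ∑ u, f u =
    ∑ i, (∑ e : Fin (A.copies b i), f (Sum.inl ⟨i, e⟩) +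
      if h : 0 < A.remainder b i then f (Sum.inr ⟨i, h⟩) else 0) := by
  have h : ∑ u, f u = ∑ p : Σ i, Fin (A.copies b i), f (Sum.inl p) +
      ∑ i : {i // 0 < A.remainder b i}, f (Sum.inr i) :=
    Fintype.sum_sum_type (α₁ := Σ i, Fin (A.copies b i)) (α₂ := {i // 0 < A.remainder b i}) f
  rw [h, Fintype.sum_sigma, Finset.sum_add_distrib]
  congr 1
  set g : Agent → ℝ := fun i => if h : 0 < A.remainder b i then f (Sum.inr ⟨i, h⟩) else 0 with hg
  calc ∑ i : {i // 0 < A.remainder b i}, f (Sum.inr i)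
      = ∑ i : {i // 0 < A.remainder b i}, g i := by
        refine Finset.sum_congr rfl fun i _ => ?_
        simp only [hg]
        rw [dif_pos i.2]
    _ = ∑ i with 0 < A.remainder b i, g i := (Finset.sum_subtype _ (by simp) g).symm
    _ = ∑ i, g i := Finset.sum_filter_of_ne fun i _ hi => by
        by_contra h
        exact hi (dif_neg h)

open Classical in
theorem sum_copyWeight_owner (hb : A.SingleBids b) (i : Agent) :
    ∑ u with A.owner b u = i, A.copyWeight b u = A.budget i := by
  rw [Finset.sum_filter, sum_copy, Finset.sum_eq_single i]
  · simp only [owner, copyWeight, if_true, Finset.sum_const, Finset.card_univ, Fintype.card_fin,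
      nsmul_eq_mul]
    -- A missing remainder copy costs nothing, since the remainder is then zero.
    have h : (if h : 0 < A.remainder b i then A.remainder b i else 0) = A.remainder b i := by
      split_ifs with h
      · rfl
      · exact le_antisymm (remainder_nonneg hb i) (not_lt.1 h)
    rw [h, remainder]
    ring
  · intro k _ hk
    simp [owner, hk]
  · simp

variable [Fintype Item]

/-- Agent by agent, the matched weight is bounded by both terms of the minimum: all copies together
weigh the budget, and each matched copy weighs at most the bid on its item. -/
theorem gain_le_revenue (hb : A.SingleBids b) {M : Item → Option (A.Copy b)}
    (hM : (A.toMatching b).IsMatching M) :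
    (A.toMatching b).gain M ≤ A.revenue (A.allocationOf b M) := by
  classical
  have hfib : (A.toMatching b).gain M =
      ∑ i, ∑ u with A.owner b u = i, if ∃ v, M v = some u then A.copyWeight b u else 0 := by
    rw [Finset.sum_fiberwise (s := Finset.univ) (g := A.owner b), gain, Finset.sum_filter]
    refine Finset.sum_congr rfl fun u _ => ?_
    split_ifs <;> rfl
  rw [hfib, revenue]
  refine Finset.sum_le_sum fun i _ => le_min ?_ ?_
  · rw [← sum_copyWeight_owner hb i]
    refine Finset.sum_le_sum fun u _ => ?_
    split_ifs
    exacts [le_rfl, (copyWeight_pos hb u).le]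
  · have h : ∑ u with ∃ v, M v = some u, (if A.owner b u = i then A.copyWeight b u else 0) =
        ∑ v, (M v).elim 0 fun u => if A.owner b u = i then A.copyWeight b u else 0 :=
      sum_matched_eq_sum_partner hM _
    rw [Finset.sum_filter] at h
    rw [Finset.sum_filter, Finset.sum_filter]
    calc _ = ∑ v, (M v).elim 0 fun u => if A.owner b u = i then A.copyWeight b u else 0 := by
          rw [← h]
          refine Finset.sum_congr rfl fun u _ => ?_
          split_ifs <;> rfl
      _ ≤ _ := by
          refine Finset.sum_le_sum fun j _ => ?_
          cases hj : M j with
          | none => simp [allocationOf, hj]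
          | some u =>
            by_cases hu : A.owner b u = i
            · have hadj : A.bid (A.owner b u) j ≠ 0 := hM.1 j u hj
              simp only [allocationOf, hj, Option.elim_some, Option.map_some, hu, if_true]
              rw [← hu, bid_eq_of_ne_zero hb hadj]
              exact copyWeight_le hb u
            · simp [allocationOf, hj, hu]

open Classical in
/-- The copy of agent `i` that serves the item with index `e` among the items of `i`. -/
noncomputable def slot (A : BudgetedAllocation Agent Item) (b : Agent → ℝ) (i : Agent) (e : ℕ) :
    Option (A.Copy b) :=
  if h : e < A.copies b i then some (Sum.inl ⟨i, e, h⟩)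
  else if h : e = A.copies b i ∧ 0 < A.remainder b i then some (Sum.inr ⟨i, h.2⟩) else none

omit [Fintype Agent] [Fintype Item] in
theorem slot_eq_inl_iff {i k : Agent} {e : ℕ} {f : Fin (A.copies b k)} :
    A.slot b i e = some (Sum.inl ⟨k, f⟩) ↔ i = k ∧ e = f := by
  unfold slot
  constructor
  · intro h
    split_ifs at h
    · cases h
      exact ⟨rfl, rfl⟩
    · cases h
  · rintro ⟨rfl, rfl⟩
    exact dif_pos f.2

omit [Fintype Agent] [Fintype Item] in
theorem slot_eq_inr_iff {i : Agent} {e : ℕ} {k : {k // 0 < A.remainder b k}} :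
    A.slot b i e = some (Sum.inr k) ↔ i = k ∧ e = A.copies b k := by
  unfold slot
  constructor
  · intro h
    split_ifs at h with h1 h2
    · cases h
    · cases h
      exact ⟨rfl, h2.1⟩
  · rintro ⟨rfl, rfl⟩
    rw [dif_neg (lt_irrefl _), dif_pos ⟨rfl, k.2⟩]
    rfl

-- Numbers from `0` the items of agent `i` that have a nonzero bid; values elsewhere play no role.
omit [Fintype Agent] in
open Classical in
theorem exists_index (A : BudgetedAllocation Agent Item) (a : Item → Option Agent) (i : Agent) :
    ∃ idx : Item → ℕ, Set.InjOn idx {j | a j = some i ∧ A.bid i j ≠ 0} ∧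
      ∀ e < ({j | a j = some i ∧ A.bid i j ≠ 0} : Finset Item).card,
        ∃ j, (a j = some i ∧ A.bid i j ≠ 0) ∧ idx j = e := by
  set T : Finset Item := {j | a j = some i ∧ A.bid i j ≠ 0} with hT
  have hmem : ∀ j, j ∈ T ↔ a j = some i ∧ A.bid i j ≠ 0 := by simp [hT]
  refine ⟨fun j => if h : j ∈ T then T.equivFin ⟨j, h⟩ else 0, ?_, ?_⟩
  · intro j hj k hk h
    have hj' := (hmem j).2 hj
    have hk' := (hmem k).2 hk
    simp only [dif_pos hj', dif_pos hk'] at h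
    exact congrArg Subtype.val (T.equivFin.injective (Fin.ext h))
  · intro e he
    refine ⟨T.equivFin.symm ⟨e, he⟩, (hmem _).1 (T.equivFin.symm ⟨e, he⟩).2, ?_⟩
    simp

/-- Zero-bid items are dropped, and the item numbered `e` goes to slot `e` of its agent, so full
copies are used first and items beyond the last copy stay unmatched. -/
theorem exists_matching_revenue_le (hb : A.SingleBids b) (a : Item → Option Agent) :
    ∃ M, (A.toMatching b).IsMatching M ∧ A.revenue a ≤ (A.toMatching b).gain M := by
  classical
  choose idx hinj hsurj using A.exists_index a
  set M : Item → Option (A.Copy b) := fun j =>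
    (a j).bind fun i => if A.bid i j ≠ 0 then A.slot b i (idx i j) else none with hMdef
  have hM : ∀ j u, M j = some u ↔
      ∃ i, (a j = some i ∧ A.bid i j ≠ 0) ∧ A.slot b i (idx i j) = some u := by
    intro j u
    simp only [hMdef, Option.bind_eq_some_iff]
    refine exists_congr fun i => ?_
    by_cases h : A.bid i j = 0 <;> simp [h]
  have hinl : ∀ i (e : Fin (A.copies b i)),
      (e : ℕ) < ({j | a j = some i ∧ A.bid i j ≠ 0} : Finset Item).card →
        ∃ j, M j = some (Sum.inl ⟨i, e⟩) := by
    intro i e he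
    obtain ⟨j, hj, hje⟩ := hsurj i e he
    exact ⟨j, (hM _ _).2 ⟨i, hj, slot_eq_inl_iff.2 ⟨rfl, hje⟩⟩⟩
  have hinr : ∀ i (h : 0 < A.remainder b i),
      A.copies b i < ({j | a j = some i ∧ A.bid i j ≠ 0} : Finset Item).card →
        ∃ j, M j = some (Sum.inr ⟨i, h⟩) := by
    intro i h he
    obtain ⟨j, hj, hje⟩ := hsurj i _ he
    exact ⟨j, (hM _ _).2 ⟨i, hj, slot_eq_inr_iff.2 ⟨rfl, hje⟩⟩⟩
  refine ⟨M, ⟨?_, ?_⟩, ?_⟩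
  · intro j u hj
    obtain ⟨i, hi, hs⟩ := (hM _ _).1 hj
    have : A.owner b u = i := by
      rcases u with ⟨k, f⟩ | k
      exacts [(slot_eq_inl_iff.1 hs).1.symm, (slot_eq_inr_iff.1 hs).1.symm]
    change A.bid (A.owner b u) j ≠ 0
    rw [this]
    exact hi.2
  · intro j k u hj hk
    obtain ⟨i, hi, hs⟩ := (hM _ _).1 hj
    obtain ⟨i', hi', hs'⟩ := (hM _ _).1 hk
    have : i = i' ∧ idx i j = idx i' k := by
      rcases u with ⟨l, f⟩ | l
      · obtain ⟨rfl, h⟩ := slot_eq_inl_iff.1 hs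
        obtain ⟨rfl, h'⟩ := slot_eq_inl_iff.1 hs'
        exact ⟨rfl, h.trans h'.symm⟩
      · obtain ⟨h1, h⟩ := slot_eq_inr_iff.1 hs
        obtain ⟨h1', h'⟩ := slot_eq_inr_iff.1 hs'
        exact ⟨h1.trans h1'.symm, h.trans h'.symm⟩
    obtain ⟨rfl, h⟩ := this
    exact hinj i hi hi' h
  · set W : A.Copy b → ℝ := fun u => if ∃ v, M v = some u then A.copyWeight b u else 0 with hW
    have hW0 : ∀ u, 0 ≤ W u := by
      intro u
      simp only [hW]
      split_ifs
      exacts [(copyWeight_pos hb u).le, le_rfl]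
    have hWm : ∀ u, (∃ v, M v = some u) → W u = A.copyWeight b u := fun u hu => if_pos hu
    have hgain : (A.toMatching b).gain M = ∑ u, W u := by
      rw [gain, Finset.sum_filter]
      refine Finset.sum_congr rfl fun u _ => ?_
      simp only [hW]
      split_ifs <;> rfl
    clear_value W
    rw [revenue, hgain, sum_copy]
    refine Finset.sum_le_sum fun i _ => ?_
    set T : Finset Item := {j | a j = some i ∧ A.bid i j ≠ 0} with hT
    have hrev : ∑ j with a j = some i, A.bid i j = T.card * b i := by
      rw [← nsmul_eq_mul, ← Finset.sum_const, hT, Finset.sum_filter, Finset.sum_filter]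
      refine Finset.sum_congr rfl fun j _ => ?_
      by_cases h : A.bid i j = 0
      · simp [h]
      · simp [bid_eq_of_ne_zero hb h, (hb.1 i).ne']
    rw [hrev]
    -- With strictly more items than full copies, index `copies` is attained, so any remainder copy
    -- is matched too and the gain from `i` is the whole budget. Otherwise every item of `T` has its
    -- own full copy of weight `b i`.
    rcases lt_or_ge (A.copies b i) T.card with hk | hk
    · refine (min_le_left _ _).trans ?_
      calc A.budget i = ∑ _e : Fin (A.copies b i), b i + A.remainder b i := by simp [remainder]
        _ ≤ _ := by
          refine add_le_add (Finset.sum_le_sum fun e _ =>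
            (hWm _ (hinl i e (e.2.trans hk))).ge) ?_
          split_ifs with h
          exacts [(hWm _ (hinr i h hk)).ge, not_lt.1 h]
    · refine (min_le_right _ _).trans (le_add_of_le_of_nonneg ?_ ?_)
      · calc (T.card : ℝ) * b i = ∑ _e : Fin T.card, b i := by simp
          _ ≤ ∑ e : Fin T.card, W (Sum.inl ⟨i, Fin.castLE hk e⟩) :=
              Finset.sum_le_sum fun e _ => (hWm _ (hinl i (Fin.castLE hk e) e.2)).ge
          _ = ∑ e ∈ Finset.univ.map (Fin.castLEEmb hk), W (Sum.inl ⟨i, e⟩) :=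
              (Finset.sum_map Finset.univ (Fin.castLEEmb hk) fun e => W (Sum.inl ⟨i, e⟩)).symm
          _ ≤ _ := Finset.sum_le_sum_of_subset_of_nonneg (Finset.subset_univ _)
              fun e _ _ => hW0 _
      · split_ifs
        exacts [hW0 _, le_rfl]

theorem opt_toMatching (hb : A.SingleBids b) : (A.toMatching b).opt = A.opt := by
  refine le_antisymm ?_ ?_
  · obtain ⟨M, hM, h⟩ := (A.toMatching b).opt_attained.1
    rw [← h]
    exact (gain_le_revenue hb hM).trans (A.opt_attained.2 ⟨_, rfl⟩)
  · obtain ⟨a, h⟩ := A.opt_attained.1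
    obtain ⟨M, hM, hle⟩ := exists_matching_revenue_le hb a
    rw [← h]
    exact hle.trans ((A.toMatching b).opt_attained.2 ⟨M, hM, rfl⟩)

end BudgetedAllocation

/-! ### The corollary for single bids. -/

theorem mainTheorem2 {Agent Item : Type*} [Fintype Agent] [Fintype Item]
    (A : BudgetedAllocation Agent Item) (b : Agent → ℝ) (hb : A.SingleBids b)
    (vid : A.Copy b → ℕ) (hvid : Function.Injective vid) {m : ℕ} (π : Fin m ≃ Item) :
    -- the reduction preserves the optimum
    (A.toMatching b).opt = A.opt ∧
    -- it does not decrease the value of a matching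
    (∀ M, (A.toMatching b).IsMatching M →
      (A.toMatching b).gain M ≤ A.revenue (A.allocationOf b M)) ∧
    -- nor the value of the algorithm, for all seeds and in expectation
    (∀ x, (A.toMatching b).IsMatching ((A.toMatching b).perturbedGreedy vid π x) ∧
      (A.toMatching b).gain ((A.toMatching b).perturbedGreedy vid π x) ≤
        A.revenue (A.perturbedGreedy b vid π x)) ∧
    MeasureTheory.Integrable
      (fun x => (A.toMatching b).gain ((A.toMatching b).perturbedGreedy vid π x))
      (uniformSeeds (A.Copy b)) ∧
    MeasureTheory.Integrable (fun x => A.revenue (A.perturbedGreedy b vid π x))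
      (uniformSeeds (A.Copy b)) ∧
    ∫ x, (A.toMatching b).gain ((A.toMatching b).perturbedGreedy vid π x)
        ∂uniformSeeds (A.Copy b) ≤
      ∫ x, A.revenue (A.perturbedGreedy b vid π x) ∂uniformSeeds (A.Copy b) ∧
    -- the competitive ratio
    (1 - 1 / Real.exp 1) * A.opt ≤
      ∫ x, A.revenue (A.perturbedGreedy b vid π x) ∂uniformSeeds (A.Copy b) := by
  have hnodup : (List.ofFn π).Nodup := List.nodup_ofFn.2 π.injective
  have hmem : ∀ j, j ∈ List.ofFn π := fun j => (List.mem_ofFn' π j).2 (π.surjective j)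
  have hgain := WeightedBipartite.integrable_comp_greedyRun (G := A.toMatching b) hvid
    (List.ofFn π) (A.toMatching b).gain
  have hrev := WeightedBipartite.integrable_comp_greedyRun (G := A.toMatching b) hvid
    (List.ofFn π) fun M => A.revenue (A.allocationOf b M)
  have hle := fun x => BudgetedAllocation.gain_le_revenue hb
    (WeightedBipartite.isMatching_greedyRun (G := A.toMatching b) (vid := vid) (x := x)
      (List.ofFn π))
  have hint := MeasureTheory.integral_mono hgain hrev hle
  have hratio := WeightedBipartite.competitive_greedyRun (G := A.toMatching b) hvid
    (fun u => (BudgetedAllocation.copyWeight_pos hb u).le) hnodup hmem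
  rw [BudgetedAllocation.opt_toMatching hb] at hratio
  exact ⟨BudgetedAllocation.opt_toMatching hb, fun M hM => BudgetedAllocation.gain_le_revenue hb hM,
    fun x => ⟨WeightedBipartite.isMatching_greedyRun _, hle x⟩, hgain, hrev, hint,
    hratio.trans hint⟩
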